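/- Let $p$ be an odd prime with $p \equiv 3 \pmod{40}$ or $p \equiv 27 \pmod{40}$, and let $E_p$ be the elliptic curve over $\mathbb{Q}$ given by $E_p : y^2 = x^3 - 5px$. Then the rank of $E_p$ over $\mathbb{Q}$ is at most $1$; that is, the abelian group $E_p(\mathbb{Q})$ of rational points is finitely generated and $E_p(\mathbb{Q}) \cong \mathbb{Z}^r \oplus E_p(\mathbb{Q})_{\mathrm{tors}}$ with $r \le 1$. -/

import Mathlib

/-- The Weierstrass curve `y² = x³ - 5 p x` over `ℚ`. -/
def curveE (p : ℕ) : WeierstrassCurve ℚ where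
  a₁ := 0
  a₂ := 0
  a₃ := 0
  a₄ := -5 * (p : ℚ)
  a₆ := 0

/-- The affine equation of `curveE p` is `y² = x³ - 5 p x`. -/
theorem curveE_equation_iff (p : ℕ) (x y : ℚ) :
    (curveE p).toAffine.Equation x y ↔ y ^ 2 = x ^ 3 - 5 * (p : ℚ) * x := by
  rw [WeierstrassCurve.Affine.equation_iff]
  simp [curveE, sub_eq_add_neg]

/-- For `p ≠ 0` the curve is an elliptic curve (its discriminant is nonzero). -/
theorem curveE_isElliptic (p : ℕ) (hp : p ≠ 0) : (curveE p).IsElliptic := by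
  have h : (curveE p).Δ = 8000 * (p : ℚ) ^ 3 := by
    simp only [curveE, WeierstrassCurve.Δ, WeierstrassCurve.b₂, WeierstrassCurve.b₄,
      WeierstrassCurve.b₆, WeierstrassCurve.b₈]
    ring
  refine ⟨?_⟩
  rw [h, isUnit_iff_ne_zero]
  positivity

/-! Put s = √(5p), so the curve is y² = x(x - s)(x + s). This is a 2-descent: points are labelled by
x and x - s modulo squares in ℚ and ℚ(s). Two points with the same label sum to a point with trivial
label (`InClass.add`), which is a double (`InClass.exists_eq_add_self`), so the number of labels
bounds the index of 2E(ℚ).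

First descent (`exists_num_eq`): a nonzero x is a square or -5p times a square. Translation by T =
(0, 0) sends x to -5p/x, so up to T one may take x square. Then x² - 5p = w² with w rational, and
2(x + w)(x - s) = (x + w - s)², so x - s has the class of the rational number 2(x + w), where 5p =
s² counts as a square. Second descent (`exists_two_mul_eq`): this class is 1, 5 or 10.

With the choice of adding T or not there are 6 labels, so the index is at most 6. Finite index and
heights give finite generation. As T has order two, rank r forces index at least 2^(r+1), hence r ≤
1. -/

/-! ### Heights: finite generation from finite index -/

-- The symmetric functions of x(P + Q) and x(P - Q) are quadratic forms in those of x(P) and x(Q),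
-- up to a common scalar that heights ignore. This yields the approximate parallelogram law.
open WeierstrassCurve in
lemma exists_addSubMap_sym2x_eq_smul (p : ℕ) (hp : p ≠ 0) (P Q : (curveE p).toAffine.Point) :
    ∃ c : ℚ, c ≠ 0 ∧ (fun i ↦ ((curveE p).addSubMap i).eval (P.sym2x Q)) =
      c • (P + Q).sym2x (P - Q) := by
  have hb₂ : (curveE p).b₂ = 0 := by simp [WeierstrassCurve.b₂, curveE]
  have hb₄ : (curveE p).b₄ = -10 * p := by simp [WeierstrassCurve.b₄, curveE]; ring
  have hb₆ : (curveE p).b₆ = 0 := by simp [WeierstrassCurve.b₆, curveE]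
  have hb₈ : (curveE p).b₈ = -25 * p ^ 2 := by simp [WeierstrassCurve.b₈, curveE]; ring
  have hF (x : Fin 3 → ℚ) : (fun i ↦ ((curveE p).addSubMap i).eval x) =
      ![x 0 ^ 2 + 10 * p * x 0 * x 2 + 25 * p ^ 2 * x 2 ^ 2,
        2 * x 1 * x 0 - 10 * p * x 1 * x 2, x 1 ^ 2 - 4 * x 0 * x 2] := by
    funext i
    fin_cases i <;> simp [addSubMap, hb₂, hb₄, hb₆, hb₈]
    ring
  have hpQ : (p : ℚ) ≠ 0 := by exact_mod_cast hp
  have hdup (P : (curveE p).toAffine.Point) : ∃ c : ℚ, c ≠ 0 ∧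
      (fun i ↦ ((curveE p).addSubMap i).eval (P.sym2x P)) = c • (P + P).sym2x 0 := by
    rw [hF]
    match P with
    | 0 => exact ⟨1, one_ne_zero, by simp⟩
    | .some x y h =>
      have hxy := (curveE_equation_iff p x y).mp h.1
      by_cases hy : y = 0
      · have h0 : Affine.Point.some x y h + .some x y h = 0 :=
          Affine.Point.add_self_of_Y_eq (by simp [Affine.negY, curveE, hy])
        refine ⟨(x ^ 2 + 5 * p) ^ 2, by positivity, ?_⟩
        rw [h0]
        subst hy
        simp
        refine ⟨by ring, by linear_combination -4 * hxy, by ring⟩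
      · have hy' : y ≠ (curveE p).toAffine.negY x y := by
          simp [curveE]
          intro h; apply hy; linarith
        rw [Affine.Point.add_self_of_Y_ne hy']
        -- The denominator in x(2P) = (x² + 5p)² / (4y²).
        refine ⟨4 * y ^ 2, by positivity, ?_⟩
        simp [Affine.slope_of_Y_ne rfl hy', Affine.addX]
        simp [curveE]
        refine ⟨?_, by linear_combination -4 * hxy, by ring⟩
        field_simp
        linear_combination (32 * x) * hxy
  match P, Q with
  | 0, 0 => simpa using hdup 0
  | 0, .some x y h =>
    refine ⟨1, one_ne_zero, ?_⟩
    rw [hF, zero_add, zero_sub, Affine.Point.sym2x_neg_right]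
    simp; ring_nf; simp
  | .some x y h, 0 =>
    refine ⟨1, one_ne_zero, ?_⟩
    rw [hF]
    simp; ring_nf; simp
  | .some x y h, .some x' y' h' =>
    by_cases hx : x = x'
    · rcases Affine.Point.X_eq_iff.mp hx with h | h
      · rw [h, sub_self]
        exact hdup _
      · rw [h, neg_add_cancel, Affine.Point.sym2x_comm 0, Affine.Point.sym2x_neg_left, ← neg_add',
          Affine.Point.sym2x_neg_left]
        exact hdup _
    · rw [hF, sub_eq_add_neg (Affine.Point.some x y h), Affine.Point.neg_some, Affine.Point.add_of_X_ne hx,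
        Affine.Point.add_of_X_ne hx]
      have hxy := (curveE_equation_iff p x y).mp h.1
      have hxy' := (curveE_equation_iff p x' y').mp h'.1
      have hs : x - x' ≠ 0 := sub_ne_zero.mpr hx
      refine ⟨(x - x') ^ 2, by positivity, ?_⟩
      simp [Affine.slope_of_X_ne hx, Affine.addX]
      simp only [curveE]
      field_simp
      refine ⟨?_, ?_, by ring⟩
      · linear_combination
          (-(y ^ 2 - y' ^ 2 + x ^ 3 - 5 * p * x - x' ^ 3 + 5 * p * x') +
            2 * (x + x') * (x - x') ^ 2) * hxy +
          ((y ^ 2 - y' ^ 2 + x ^ 3 - 5 * p * x - x' ^ 3 + 5 * p * x') +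
            2 * (x + x') * (x - x') ^ 2) * hxy'
      · linear_combination -2 * hxy - 2 * hxy'


open WeierstrassCurve Height in
theorem fg_of_finiteIndex_two (p : ℕ) (hp : p ≠ 0)
    (h : (nsmulAddMonoidHom (α := (curveE p).toAffine.Point) 2).range.FiniteIndex) :
    AddGroup.FG (curveE p).toAffine.Point := by
  have := curveE_isElliptic p hp
  obtain ⟨C₁, hC₁⟩ := abs_logHeight_addSubMap_sub_two_mul_logHeight_le (curveE p)
  obtain ⟨C₂, hC₂⟩ := abs_logHeight_sym2_sub_le ℚ
  let ht (P : (curveE p).toAffine.Point) : ℝ := logHeight P.xRep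
  have hsym (P Q : (curveE p).toAffine.Point) :
      |logHeight (P.sym2x Q) - (ht P + ht Q)| ≤ C₂ := by
    have key (v w : Fin 2 → ℚ) (hv : v ≠ 0) (hw : w ≠ 0) :
        |logHeight ![v 0 * w 0, v 0 * w 1 + v 1 * w 0, v 1 * w 1] - (logHeight v + logHeight w)|
          ≤ C₂ := by
      have eta (v : Fin 2 → ℚ) : v = ![v 0, v 1] := by
        funext i; fin_cases i <;> rfl
      have := hC₂ (eta v ▸ hv) (eta w ▸ hw)
      rwa [← eta v, ← eta w] at this
    exact key _ _ P.xRep_ne_zero Q.xRep_ne_zero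
  have hN : Northcott ht := by
    refine ⟨fun B ↦ ?_⟩
    have hfin := (NumberField.finite_setOfPred_logHeight₁_le ℚ B).image (fun x : ℚ ↦ ![x, 1])
    have hfin' := hfin.union (Set.finite_singleton (![1, 0] : Fin 2 → ℚ))
    -- Bounded height leaves finitely many x-coordinates, and each is shared only by P and -P.
    refine Set.Finite.of_finite_fibers Affine.Point.xRep (hfin'.subset ?_) fun v _ ↦ ?_
    · rintro _ ⟨P, hP, rfl⟩
      match P with
      | 0 => right; simp
      | .some x y h =>
        left
        refine ⟨x, ?_, by simp⟩
        simpa [logHeight₁_eq_logHeight, ht] using hP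
    · by_cases hv : ∃ P : (curveE p).toAffine.Point, P.xRep = v
      · obtain ⟨P, rfl⟩ := hv
        refine (Set.toFinite {P, -P}).subset ?_
        rintro Q ⟨-, hQ⟩
        exact Affine.Point.eq_or_eq_neg_of_xRep_eq_xRep hQ
      · refine Set.finite_empty.subset ?_
        rintro Q ⟨-, hQ⟩
        exact hv ⟨Q, hQ⟩
  -- The Sym² error `C₂` enters twice for the pair (P, Q) and once for (P + Q, P - Q).
  refine AddCommGroup.fg_of_descent' (h := ht) (C := C₁ + 3 * C₂) h (fun P ↦ logHeight_nonneg _)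
    fun P Q ↦ ?_
  obtain ⟨c, hc, hPQ⟩ := exists_addSubMap_sym2x_eq_smul p hp P Q
  have h₁ := hC₁ (P.sym2x Q)
  rw [hPQ, logHeight_smul_eq_logHeight _ hc] at h₁
  have h₂ := hsym P Q
  have h₃ := hsym (P + Q) (P - Q)
  rw [abs_le] at *
  constructor <;> linarith

/-! ### Labels modulo squares and divisibility by two -/

/-- The class of `x(P) - √(5p)` in `ℚ(√(5p))ˣ` modulo squares is represented by the rational
number `c`, and `x(P)` is itself a rational square. -/
def InClass (p : ℕ) (c : ℚ) : (curveE p).toAffine.Point → Prop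
  | 0 => c = 1
  | .some x _ _ => ∃ t u v : ℚ, t ≠ 0 ∧ x = t ^ 2 ∧ x = c * (u ^ 2 + 5 * p * v ^ 2) ∧
      2 * c * u * v = -1

/-- The point `(0, 0)`. -/
def twoTorsionPoint (p : ℕ) (hp : p ≠ 0) : (curveE p).toAffine.Point :=
  .some 0 0 (by
    rw [WeierstrassCurve.Affine.nonsingular_iff]
    exact ⟨(curveE_equation_iff p 0 0).mpr (by simp), by simp [curveE, hp]⟩)

open WeierstrassCurve in
/-- A point `P` with `x(P)` and `x(P) - √(5p)` both squares is divisible by two. -/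
lemma InClass.exists_eq_add_self {p : ℕ} (hp : ¬ IsSquare (5 * p : ℚ))
    {P : (curveE p).toAffine.Point} (h : InClass p 1 P) : ∃ R, P = R + R := by
  match P with
  | 0 => exact ⟨0, by simp⟩
  | .some x y hxy =>
    obtain ⟨t, u, v, ht, hx, hx', huv⟩ := h
    have hE := (curveE_equation_iff p x y).mp hxy.1
    have hu : u ≠ 0 := by rintro rfl; simp at huv
    have hv : v ≠ 0 := by rintro rfl; simp at huv
    have hy2 : y ^ 2 = (t * (u ^ 2 - 5 * p * v ^ 2)) ^ 2 := by
      rw [hE]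
      have : x ^ 2 - 5 * p = (u ^ 2 - 5 * p * v ^ 2) ^ 2 := by
        rw [hx']
        linear_combination 5 * (p : ℚ) * (2 * u * v - 1) * huv
      linear_combination x * this + (u ^ 2 - 5 * p * v ^ 2) ^ 2 * hx
    obtain ⟨t, ht, hx, hy⟩ : ∃ t : ℚ, t ≠ 0 ∧ x = t ^ 2 ∧ y = t * (u ^ 2 - 5 * p * v ^ 2) := by
      rcases sq_eq_sq_iff_eq_or_eq_neg.mp hy2 with h | h
      · exact ⟨t, ht, hx, h⟩
      · exact ⟨-t, neg_ne_zero.mpr ht, by rw [hx]; ring, by rw [h]; ring⟩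
    have hp' : p ≠ 0 := by rintro rfl; simp at hp
    have := curveE_isElliptic p hp'
    -- Halving formula: with r₁ = t, r₂ = u + vs, r₃ = u - vs the square roots of x, x - s, x + s,
    -- signed so that y = r₁r₂r₃, a half has X = (r₁ + r₂)(r₁ + r₃), Y = (r₂ + r₃)X and tangent
    -- slope r₁ + r₂ + r₃. X is the norm of t + u + vs, hence nonzero.
    obtain ⟨X, hX⟩ : ∃ X, X = (t + u) ^ 2 - 5 * p * v ^ 2 := ⟨_, rfl⟩
    have hX0 : X ≠ 0 := by
      rintro rfl
      refine hp ⟨(t + u) / v, ?_⟩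
      field_simp
      linear_combination hX
    have hX' : X = 2 * u * (t + u) := by linear_combination hX - hx + hx'
    have hX2 : X ^ 2 = 5 * p + 4 * u ^ 2 * X := by
      linear_combination (X + 2 * u * (t + u)) * hX' - 4 * u ^ 2 * hX +
        5 * p * (2 * u * v - 1) * huv
    have hY0 : 2 * u * X ≠ 0 := by positivity
    have hR : (curveE p).toAffine.Equation X (2 * u * X) := by
      rw [curveE_equation_iff]
      linear_combination -X * hX2
    have hR' : (curveE p).toAffine.Nonsingular X (2 * u * X) :=
      (Affine.equation_iff_nonsingular).mp hR
    have hY : 2 * u * X ≠ (curveE p).toAffine.negY X (2 * u * X) := by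
      simp [curveE]
      intro h
      apply hY0
      linarith
    refine ⟨.some X (2 * u * X) hR', ?_⟩
    have hs : (curveE p).toAffine.slope X X (2 * u * X) (2 * u * X) = t + 2 * u := by
      rw [Affine.slope_of_Y_ne rfl hY]
      simp [curveE]
      field_simp
      linear_combination hX2 + 2 * X * hX'
    rw [Affine.Point.add_self_of_Y_ne hY]
    simp only [Affine.Point.some.injEq, Affine.addY, Affine.negAddY, hs, Affine.addX, Affine.negY]
    simp only [curveE]
    constructor
    · linear_combination hx + 2 * hX'
    · linear_combination hy + t * hx' - t * hx - (3 * t + 4 * u) * hX'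

open WeierstrassCurve in
/-- The relations between the coordinates of three collinear points. -/
lemma exists_add_some_eq {p : ℕ} {x₁ y₁ x₂ y₂ : ℚ} {h₁ : (curveE p).toAffine.Nonsingular x₁ y₁}
    {h₂ : (curveE p).toAffine.Nonsingular x₂ y₂}
    (h : Affine.Point.some x₁ y₁ h₁ + .some x₂ y₂ h₂ ≠ 0) :
    ∃ x₃ y₃, ∃ h₃ : (curveE p).toAffine.Nonsingular x₃ y₃,
      Affine.Point.some x₁ y₁ h₁ + .some x₂ y₂ h₂ = .some x₃ y₃ h₃ ∧
      ∃ l n : ℚ, x₁ + x₂ + x₃ = l ^ 2 ∧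
        x₁ * x₂ + x₁ * x₃ + x₂ * x₃ = -5 * p - 2 * l * n ∧ x₁ * x₂ * x₃ = n ^ 2 := by
  have hxy : ¬(x₁ = x₂ ∧ y₁ = (curveE p).toAffine.negY x₂ y₂) :=
    fun h' ↦ h (Affine.Point.add_of_Y_eq h'.1 h'.2)
  have key := Affine.addPolynomial_slope h₁.1 h₂.1 hxy
  refine ⟨_, _, _, Affine.Point.add_some hxy, (curveE p).toAffine.slope x₁ x₂ y₁ y₂,
    y₁ - (curveE p).toAffine.slope x₁ x₂ y₁ y₂ * x₁, ?_⟩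
  generalize (curveE p).toAffine.slope x₁ x₂ y₁ y₂ = l at key ⊢
  have e₁ : x₁ + x₂ + (curveE p).toAffine.addX x₁ x₂ l = l ^ 2 := by
    simp [Affine.addX, curveE]
  generalize (curveE p).toAffine.addX x₁ x₂ l = x₃ at key e₁ ⊢
  -- Vieta for the line y = lx + n: the values at 0 and 1, with `e₁`, determine the remaining
  -- coefficients.
  have k0 := congrArg (Polynomial.eval 0) key
  have k1 := congrArg (Polynomial.eval 1) key
  simp [Affine.addPolynomial_eq, Cubic.toPoly, curveE] at k0 k1
  refine ⟨e₁, ?_, ?_⟩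
  · linear_combination k1 - k0 + e₁
  · linear_combination -k0

-- Evaluating the cubic of the line through P and Q at s gives (x₁ - s)(x₂ - s)(x₃ - s) = (n + ls)²,
-- and at 0 gives x₁x₂x₃ = n². Equal classes make the first two factors multiply to a square, so the
-- third is a square too.
open WeierstrassCurve in
lemma InClass.add {p : ℕ} (hp : ¬ IsSquare (5 * p : ℚ)) {c : ℚ}
    {P Q : (curveE p).toAffine.Point} (hP : InClass p c P) (hQ : InClass p c Q) :
    InClass p 1 (P + Q) := by
  by_cases hPQ : P + Q = 0
  · rw [hPQ]; exact rfl
  match P, Q with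
  | 0, Q => obtain rfl : c = 1 := hP; simpa using hQ
  | .some x y h, 0 => obtain rfl : c = 1 := hQ; simpa using hP
  | .some x₁ y₁ h₁, .some x₂ y₂ h₂ =>
    obtain ⟨x₃, y₃, h₃, e, l, n, e₁, e₂, e₃⟩ := exists_add_some_eq hPQ
    rw [e]
    obtain ⟨t₁, u₁, v₁, ht₁, hx₁, hx₁', huv₁⟩ := hP
    obtain ⟨t₂, u₂, v₂, ht₂, hx₂, hx₂', huv₂⟩ := hQ
    show ∃ t u v : ℚ, t ≠ 0 ∧ x₃ = t ^ 2 ∧ x₃ = 1 * (u ^ 2 + 5 * p * v ^ 2) ∧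
      2 * 1 * u * v = -1
    have hp0 : (p : ℚ) ≠ 0 := by rintro h; simp [h] at hp
    have hn : n ≠ 0 := by
      rintro rfl
      have hx₁0 : x₁ ≠ 0 := by rw [hx₁]; positivity
      have hx₂0 : x₂ ≠ 0 := by rw [hx₂]; positivity
      have hx₃0 : x₃ = 0 := by
        have : x₁ * x₂ * x₃ = 0 := by rw [e₃]; ring
        simpa [hx₁0, hx₂0] using this
      have h1 : (t₁ * t₂) ^ 2 + 5 * p = 0 := by
        rw [hx₃0, hx₁, hx₂] at e₂
        linear_combination e₂
      have : (0 : ℚ) < (t₁ * t₂) ^ 2 + 5 * p := by positivity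
      exact this.ne' h1
    have hc : c ≠ 0 := by rintro rfl; simp at huv₁
    have hN {u v : ℚ} (h : 2 * c * u * v = -1) : u ^ 2 - 5 * p * v ^ 2 ≠ 0 := by
      intro h0
      have hv : v ≠ 0 := by rintro rfl; simp at h
      refine hp ⟨u / v, ?_⟩
      field_simp
      linear_combination -h0
    have hN₁ := hN huv₁
    have hN₂ := hN huv₂
    obtain ⟨a, ha⟩ : ∃ a, a = c * (u₁ * u₂ + 5 * p * v₁ * v₂) := ⟨_, rfl⟩
    obtain ⟨b, hb⟩ : ∃ b, b = c * (u₁ * v₂ + v₁ * u₂) := ⟨_, rfl⟩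
    have hM : a ^ 2 - 5 * p * b ^ 2 ≠ 0 := by
      have : a ^ 2 - 5 * p * b ^ 2 =
          c ^ 2 * (u₁ ^ 2 - 5 * p * v₁ ^ 2) * (u₂ ^ 2 - 5 * p * v₂ ^ 2) := by rw [ha, hb]; ring
      rw [this]
      positivity
    -- `(x₃ - s) * (a + b * s) ^ 2 = (n + l * s) ^ 2` where `s = √(5p)`
    have hA : a ^ 2 + 5 * p * b ^ 2 = x₁ * x₂ + 5 * p := by
      rw [ha, hb, hx₁', hx₂']
      linear_combination 5 * p * (2 * c * u₁ * v₁) * huv₂ - 5 * p * huv₁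
    have hB : 2 * a * b = -(x₁ + x₂) := by
      rw [ha, hb]
      linear_combination c * (u₂ ^ 2 + 5 * p * v₂ ^ 2) * huv₁ +
        c * (u₁ ^ 2 + 5 * p * v₁ ^ 2) * huv₂ + hx₁' + hx₂'
    have k₁ : x₃ * (a ^ 2 + 5 * p * b ^ 2) - 5 * p * (2 * a * b) = n ^ 2 + 5 * p * l ^ 2 := by
      rw [hA, hB]
      linear_combination e₃ + 5 * p * e₁
    have k₂ : x₃ * (2 * a * b) - (a ^ 2 + 5 * p * b ^ 2) = 2 * n * l := by
      rw [hA, hB]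
      linear_combination -e₂
    -- The last two are the coordinates of (n + ls)/(a + bs), after multiplying by the conjugate a -
    -- bs.
    refine ⟨n / (t₁ * t₂), (n * a - 5 * p * l * b) / (a ^ 2 - 5 * p * b ^ 2),
      (l * a - n * b) / (a ^ 2 - 5 * p * b ^ 2), by positivity, ?_, ?_, ?_⟩
    · rw [hx₁, hx₂] at e₃
      field_simp
      linear_combination e₃
    · field_simp
      linear_combination (a ^ 2 + 5 * p * b ^ 2) * k₁ - 5 * p * (2 * a * b) * k₂
    · field_simp
      linear_combination (2 * a * b) * k₁ - (a ^ 2 + 5 * p * b ^ 2) * k₂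

/-! ### Rank and the index of doubling -/

/-- A finitely generated abelian group with a point of order two in which doubling has index
less than eight has rank at most one. -/
theorem finrank_le_one_of_index_lt {G : Type*} [AddCommGroup G] [Module.Finite ℤ G] {t : G}
    (ht : t ≠ 0) (ht2 : t + t = 0) (h0 : (nsmulAddMonoidHom (α := G) 2).range.index ≠ 0)
    (h : (nsmulAddMonoidHom (α := G) 2).range.index < 8) : Module.finrank ℤ G ≤ 1 := by
  by_contra! hr
  let S := Submodule.torsion ℤ G
  have hSt : Module.IsTorsion ℤ S := Submodule.torsion_isTorsion
  have : Finite S := Module.finite_of_fg_torsion S hSt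
  have hmem {g : G} : g ∈ S ↔ ∃ a : ℤ, a ≠ 0 ∧ a • g = 0 := by
    rw [Submodule.mem_torsion_iff]
    constructor
    · rintro ⟨a, ha⟩
      exact ⟨a, nonZeroDivisors.ne_zero a.2, ha⟩
    · rintro ⟨a, ha, hag⟩
      exact ⟨⟨a, mem_nonZeroDivisors_of_ne_zero ha⟩, hag⟩
  -- Doubling on the finite torsion group kills `t`, so it is not injective and hence not
  -- surjective.
  obtain ⟨s, hs⟩ : ∃ s : S, ∀ r : S, r + r ≠ s := by
    by_contra! hsurj
    have hinj : Function.Injective fun r : S ↦ r + r := Finite.injective_iff_surjective.mpr hsurj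
    have htS : t ∈ S := hmem.mpr ⟨2, by norm_num, by rw [two_zsmul, ht2]⟩
    have : (⟨t, htS⟩ : S) = 0 := hinj (Subtype.ext (by simpa using ht2))
    exact ht (congrArg Subtype.val this)
  have hs' : (s : G) ∉ (nsmulAddMonoidHom (α := G) 2).range := by
    rintro ⟨g, hg⟩
    replace hg : g + g = s := by simpa [two_nsmul] using hg
    obtain ⟨a, ha, has⟩ := hmem.mp s.2
    have hgS : g ∈ S := hmem.mpr ⟨a * 2, by positivity, by
      rw [mul_smul, two_zsmul, hg, has]⟩
    exact hs ⟨g, hgS⟩ (Subtype.ext hg)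
  let b := Module.finBasis ℤ (G ⧸ S)
  have hr' : 1 < Module.finrank ℤ (G ⧸ S) := by
    rwa [finrank_quotient_eq_of_le_torsion le_rfl]
  -- Reduction of the free quotient modulo 2. Its kernel contains 2G strictly, because of `s`, which
  -- supplies the extra factor 2.
  let ψ : G →+ (Fin (Module.finrank ℤ (G ⧸ S)) → ZMod 2) :=
    ((Int.castAddHom (ZMod 2)).compLeft _).comp
      (b.equivFun.toLinearMap.toAddMonoidHom.comp S.mkQ.toAddMonoidHom)
  have hψ : Function.Surjective ψ := by
    intro v
    obtain ⟨g, hg⟩ := S.mkQ_surjective (b.equivFun.symm fun i ↦ ((v i).val : ℤ))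
    refine ⟨g, funext fun i ↦ ?_⟩
    have : b.equivFun (S.mkQ g) = fun i ↦ ((v i).val : ℤ) := by
      rw [hg, LinearEquiv.apply_symm_apply]
    have h1 : ψ g i = ((b.equivFun (S.mkQ g) i : ℤ) : ZMod 2) := rfl
    rw [h1, this]
    simp
  have hker : ψ.ker.index = 2 ^ Module.finrank ℤ (G ⧸ S) := by
    rw [AddSubgroup.index_ker, AddMonoidHom.range_eq_top.mpr hψ]
    simp
  have hle : (nsmulAddMonoidHom (α := G) 2).range ≤ ψ.ker := by
    rintro _ ⟨g, rfl⟩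
    rw [AddMonoidHom.mem_ker]
    funext i
    have h2 : (2 : ZMod 2) = 0 := rfl
    simp [h2]
  have hsker : (s : G) ∈ ψ.ker := by
    rw [AddMonoidHom.mem_ker]
    have : S.mkQ (s : G) = 0 := by simp
    funext i
    have h1 : ψ s i = ((b.equivFun (S.mkQ (s : G)) i : ℤ) : ZMod 2) := rfl
    rw [h1, this]
    simp
  have hmul := AddSubgroup.relIndex_mul_index hle
  have h1 : (nsmulAddMonoidHom (α := G) 2).range.relIndex ψ.ker ≠ 1 := by
    rw [Ne, AddSubgroup.relIndex_eq_one]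
    exact fun h ↦ hs' (h hsker)
  have h2 : (nsmulAddMonoidHom (α := G) 2).range.relIndex ψ.ker ≠ 0 := by
    intro h
    rw [h, zero_mul] at hmul
    exact h0 hmul.symm
  have h4 : 2 ^ 2 ≤ 2 ^ Module.finrank ℤ (G ⧸ S) := Nat.pow_le_pow_right (by norm_num) hr'
  rw [hker] at hmul
  have : 2 * 2 ^ 2 ≤ (nsmulAddMonoidHom (α := G) 2).range.index := by
    rw [← hmul]
    exact Nat.mul_le_mul (by omega) h4
  omega

/-! ### First descent -/

lemma five_dvd_of_sq_eq {c : ℤ} (hc : c % 5 = 2 ∨ c % 5 = 3) {a b d : ℤ}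
    (h : a ^ 2 = c * b ^ 2 + 5 * d) : 5 ∣ a ∧ 5 ∣ b := by
  have h' : a ^ 2 % 5 = (c * b ^ 2) % 5 := by omega
  have ha : a % 5 = 0 ∨ a % 5 = 1 ∨ a % 5 = 2 ∨ a % 5 = 3 ∨ a % 5 = 4 := by omega
  have hb : b % 5 = 0 ∨ b % 5 = 1 ∨ b % 5 = 2 ∨ b % 5 = 3 ∨ b % 5 = 4 := by omega
  rcases hc with hc | hc <;> rcases ha with ha | ha | ha | ha | ha <;>
    rcases hb with hb | hb | hb | hb | hb <;>
    simp [pow_two, Int.mul_emod, hc, ha, hb] at h' <;> omega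

lemma dvd_of_sq_add_sq {p : ℕ} (hp : p.Prime) (hp4 : p % 4 = 3) {a b d : ℤ}
    (h : a ^ 2 + b ^ 2 = p * d) : (p : ℤ) ∣ b := by
  have := Fact.mk hp
  rw [← ZMod.intCast_zmod_eq_zero_iff_dvd]
  by_contra hb
  refine ZMod.mod_four_ne_three_of_sq_eq_neg_sq' (p := p) (x := a) hb ?_ hp4
  have := congrArg (Int.cast : ℤ → ZMod p) h
  push_cast at this
  simp at this
  linear_combination this

/-- Here gh will be a factorisation of 5p. Dividing by g² leaves two coprime factors with square
product, so each is a square up to sign. Opposite signs force one of them to vanish. -/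
lemma exists_sq_eq_of_mul_eq_sq {g h m e N : ℤ} (hg : g ≠ 0)
    (H : g * m * ((g * m) ^ 2 - g * h * e ^ 4) = N ^ 2) (hmh : IsCoprime m h)
    (hme : IsCoprime m e) : ∃ k l : ℤ, (m = k ^ 2 ∧ g * k ^ 4 - h * e ^ 4 = l ^ 2) ∨
      (m = -k ^ 2 ∧ g * k ^ 4 - h * e ^ 4 = -l ^ 2) := by
  have hgN : g ∣ N := by
    rw [← Int.pow_dvd_pow_iff two_ne_zero]
    exact ⟨m * (g * m ^ 2 - h * e ^ 4), by rw [← H]; ring⟩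
  obtain ⟨N, rfl⟩ := hgN
  have H' : m * (g * m ^ 2 - h * e ^ 4) = N ^ 2 := by
    have : g ^ 2 ≠ 0 := by positivity
    apply mul_left_cancel₀ this
    linear_combination H
  have hcop : IsCoprime m (g * m ^ 2 - h * e ^ 4) := by
    have h1 : IsCoprime m (-(h * e ^ 4)) := (hmh.mul_right hme.pow_right).neg_right
    have := h1.add_mul_left_right (g * m)
    rwa [show -(h * e ^ 4) + m * (g * m) = g * m ^ 2 - h * e ^ 4 by ring] at this
  obtain ⟨k, hk⟩ := Int.sq_of_isCoprime hcop H'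
  obtain ⟨l, hl⟩ := Int.sq_of_isCoprime hcop.symm (by rw [mul_comm]; exact H')
  have hk4 : k ^ 4 = m ^ 2 := by rcases hk with hk | hk <;> rw [hk] <;> ring
  rw [← hk4] at hl
  rcases hk with hk | hk <;> rcases hl with hl | hl
  · exact ⟨k, l, .inl ⟨hk, hl⟩⟩
  · have h0 : k * l = 0 := by
      rw [← hk4, hl, hk] at H'
      have : (k * l) ^ 2 = 0 := by nlinarith [sq_nonneg (k * l), sq_nonneg N]
      simpa using this
    rcases mul_eq_zero.mp h0 with rfl | rfl
    · exact ⟨0, l, .inr ⟨by simpa using hk, hl⟩⟩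
    · exact ⟨k, 0, .inl ⟨hk, by simpa using hl⟩⟩
  · have h0 : k * l = 0 := by
      rw [← hk4, hl, hk] at H'
      have : (k * l) ^ 2 = 0 := by nlinarith [sq_nonneg (k * l), sq_nonneg N]
      simpa using this
    rcases mul_eq_zero.mp h0 with rfl | rfl
    · exact ⟨0, l, .inl ⟨by simpa using hk, hl⟩⟩
    · exact ⟨k, 0, .inr ⟨hk, by simpa using hl⟩⟩
  · exact ⟨k, l, .inr ⟨hk, hl⟩⟩

/-- The first descent: the numerator of a nonzero `x`-coordinate is a square or
`-5p` times a square. -/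
lemma exists_num_eq {p : ℕ} (hp : p.Prime) (hp4 : p % 4 = 3) (hp5 : p % 5 = 2 ∨ p % 5 = 3)
    {m e N : ℤ} (hme : IsCoprime m e) (H : m * (m ^ 2 - 5 * p * e ^ 4) = N ^ 2) :
    ∃ k : ℤ, m = k ^ 2 ∨ m = -5 * p * k ^ 2 := by
  have hpZ : Prime (p : ℤ) := Nat.prime_iff_prime_int.mp hp
  have h5Z : Prime (5 : ℤ) := by norm_num
  have hp0 : (p : ℤ) ≠ 0 := hpZ.ne_zero
  have hnp {x y : ℤ} (h : IsCoprime x y) {q : ℤ} (hq : Prime q) (hx : q ∣ x) : ¬ q ∣ y :=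
    fun hy ↦ hq.not_isUnit (h.isUnit_of_dvd' hx hy)
  have hcop {q x : ℤ} (hq : Prime q) (h : ¬ q ∣ x) : IsCoprime x q :=
    ((hq.coprime_iff_not_dvd).mpr h).symm
  -- Cases on gcd(m, 5p). When it is 5 or p, both signs fail modulo 5, where ±p are non-residues.
  -- When it is 1 or 5p, one sign fails modulo p, where -1 is a non-residue.
  by_cases h5 : (5 : ℤ) ∣ m
  · obtain ⟨m, rfl⟩ := h5
    have h5e := hnp hme h5Z (dvd_mul_right 5 m)
    by_cases hpm : (p : ℤ) ∣ m
    · obtain ⟨m, rfl⟩ := hpm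
      have hpe := hnp hme hpZ ⟨5 * m, by ring⟩
      obtain ⟨k, l, ⟨hk, hl⟩ | ⟨hk, hl⟩⟩ := exists_sq_eq_of_mul_eq_sq
        (g := 5 * p) (h := 1) (m := m) (e := e) (N := N)
        (by positivity) (by linear_combination H) isCoprime_one_right
        (hme.of_isCoprime_of_dvd_left ⟨5 * p, by ring⟩)
      · refine absurd (hpZ.dvd_of_dvd_pow (n := 2) ?_) hpe
        exact dvd_of_sq_add_sq hp hp4 (a := l) (d := 5 * k ^ 4) (by linear_combination -hl)
      · exact ⟨k, .inr (by rw [hk]; ring)⟩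
    · obtain ⟨k, l, h⟩ := exists_sq_eq_of_mul_eq_sq
        (g := 5) (h := p) (m := m) (e := e) (N := N) (by norm_num)
        (by linear_combination H) (hcop hpZ hpm) (hme.of_isCoprime_of_dvd_left ⟨5, by ring⟩)
      refine absurd (h5Z.dvd_of_dvd_pow (n := 2) ?_) h5e
      rcases h with ⟨hk, hl⟩ | ⟨hk, hl⟩
      · exact (five_dvd_of_sq_eq (c := -p) (by omega) (a := l) (d := k ^ 4)
          (by linear_combination -hl)).2
      · exact (five_dvd_of_sq_eq (c := p) (by omega) (a := l) (d := -k ^ 4)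
          (by linear_combination hl)).2
  · by_cases hpm : (p : ℤ) ∣ m
    · obtain ⟨m, rfl⟩ := hpm
      have h5m : ¬ (5 : ℤ) ∣ m := fun h ↦ h5 (h.mul_left _)
      obtain ⟨k, l, h⟩ := exists_sq_eq_of_mul_eq_sq
        (g := p) (h := 5) (m := m) (e := e) (N := N) hp0
        (by linear_combination H) (hcop h5Z h5m) (hme.of_isCoprime_of_dvd_left ⟨p, by ring⟩)
      refine absurd ?_ h5m
      rcases h with ⟨hk, hl⟩ | ⟨hk, hl⟩
      · rw [hk]
        exact (five_dvd_of_sq_eq (c := p) (by omega) (a := l) (d := -e ^ 4)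
          (by linear_combination -hl)).2
      · rw [hk, dvd_neg]
        exact (five_dvd_of_sq_eq (c := -p) (by omega) (a := l) (d := e ^ 4)
          (by linear_combination hl)).2
    · obtain ⟨k, l, ⟨hk, hl⟩ | ⟨hk, hl⟩⟩ := exists_sq_eq_of_mul_eq_sq
        (g := 1) (h := 5 * p) (m := m) (e := e) (N := N)
        (by norm_num) (by linear_combination H) ((hcop h5Z h5).mul_right (hcop hpZ hpm)) hme
      · exact ⟨k, .inl hk⟩
      · refine absurd ?_ hpm
        rw [hk, dvd_neg]
        exact dvd_of_sq_add_sq hp hp4 (a := l) (d := 5 * e ^ 4) (by linear_combination hl)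

/-! ### Second descent -/

lemma exists_sq_of_mul_eq_prime_mul_sq {q A B m : ℤ} (hq : Prime q) (hq0 : 0 < q) (hA : 0 < A)
    (hB : 0 < B) (hAB : IsCoprime A B) (H : A * B = q * m ^ 2) :
    ∃ k l : ℤ, (A = k ^ 2 ∧ B = q * l ^ 2) ∨ (A = q * k ^ 2 ∧ B = l ^ 2) := by
  have pos {x y z : ℤ} (hx : 0 < x) (hy : 0 < y) (hxy : IsCoprime x y) (h : x * y = z ^ 2) :
      ∃ k l : ℤ, x = k ^ 2 ∧ y = l ^ 2 := by
    obtain ⟨k, hk⟩ := Int.sq_of_isCoprime hxy h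
    obtain ⟨l, hl⟩ := Int.sq_of_isCoprime hxy.symm (by rw [mul_comm]; exact h)
    exact ⟨k, l, hk.resolve_right (by nlinarith [sq_nonneg k]),
      hl.resolve_right (by nlinarith [sq_nonneg l])⟩
  rcases hq.dvd_or_dvd (Dvd.intro _ H.symm) with ⟨A, rfl⟩ | ⟨B, rfl⟩
  · obtain ⟨k, l, hk, hl⟩ := pos (z := m) (pos_of_mul_pos_right hA hq0.le) hB
      (hAB.of_isCoprime_of_dvd_left ⟨q, by ring⟩)
      (mul_left_cancel₀ hq.ne_zero (by linear_combination H))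
    exact ⟨k, l, .inr ⟨by rw [hk], hl⟩⟩
  · obtain ⟨k, l, hk, hl⟩ := pos (z := m) hA (pos_of_mul_pos_right hB hq0.le)
      (hAB.of_isCoprime_of_dvd_right ⟨q, by ring⟩)
      (mul_left_cancel₀ hq.ne_zero (by linear_combination H))
    exact ⟨k, l, .inl ⟨hk, by rw [hl]⟩⟩

lemma exists_sq_of_mul_eq_prime_mul_prime_mul_sq {q r A B m : ℤ} (hq : Prime q) (hq0 : 0 < q)
    (hr : Prime r) (hr0 : 0 < r) (hA : 0 < A) (hB : 0 < B) (hAB : IsCoprime A B)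
    (H : A * B = q * r * m ^ 2) :
    ∃ k l : ℤ, (A = k ^ 2 ∧ B = q * r * l ^ 2) ∨ (A = q * k ^ 2 ∧ B = r * l ^ 2) ∨
      (A = r * k ^ 2 ∧ B = q * l ^ 2) ∨ (A = q * r * k ^ 2 ∧ B = l ^ 2) := by
  rcases hq.dvd_or_dvd (a := A) (b := B) ⟨r * m ^ 2, by linear_combination H⟩ with ⟨A, rfl⟩ | ⟨B, rfl⟩
  · obtain ⟨k, l, h | h⟩ := exists_sq_of_mul_eq_prime_mul_sq (m := m) hr hr0
      (pos_of_mul_pos_right hA hq0.le) hB (hAB.of_isCoprime_of_dvd_left ⟨q, by ring⟩)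
      (mul_left_cancel₀ hq.ne_zero (by linear_combination H))
    · exact ⟨k, l, .inr <| .inl ⟨by rw [h.1], h.2⟩⟩
    · exact ⟨k, l, .inr <| .inr <| .inr ⟨by rw [h.1]; ring, h.2⟩⟩
  · obtain ⟨k, l, h | h⟩ := exists_sq_of_mul_eq_prime_mul_sq (m := m) hr hr0 hA
      (pos_of_mul_pos_right hB hq0.le) (hAB.of_isCoprime_of_dvd_right ⟨q, by ring⟩)
      (mul_left_cancel₀ hq.ne_zero (by linear_combination H))
    · exact ⟨k, l, .inl ⟨h.1, by rw [h.2]; ring⟩⟩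
    · exact ⟨k, l, .inr <| .inr <| .inl ⟨h.1, by rw [h.2]⟩⟩

/-- A common prime q divides a, hence not b, so q² would divide the squarefree number 5p. -/
lemma isCoprime_of_mul_dvd {p : ℕ} (hp : p.Prime) (hp5 : p % 5 = 2 ∨ p % 5 = 3) {a b A B : ℤ}
    (hab : IsCoprime a b) (hA : A ≠ 0) (hAB : A * B ∣ 5 * p * b ^ 4)
    (ha : ∀ q, Prime q → q ∣ A → q ∣ B → q ∣ a) : IsCoprime A B := by
  refine isCoprime_of_prime_dvd (fun h ↦ hA h.1) fun q hq hqA hqB ↦ ?_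
  have hqa := ha q hq hqA hqB
  have hqb : IsCoprime (q * q) (b ^ 4) := by
    have := hab.of_isCoprime_of_dvd_left hqa
    exact (this.mul_left this).pow_right
  have hq2 : q * q ∣ 5 * p := hqb.dvd_of_dvd_mul_right ((mul_dvd_mul hqA hqB).trans hAB)
  have hsq : Squarefree (5 * p : ℤ) := by
    have : Squarefree (5 * p) := by
      refine (Nat.squarefree_mul ?_).mpr ⟨Nat.prime_five.prime.squarefree, hp.prime.squarefree⟩
      refine (Nat.coprime_primes Nat.prime_five hp).mpr ?_
      rintro rfl
      omega
    exact_mod_cast Int.squarefree_natCast.mpr this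
  exact hq.not_isUnit (hsq q hq2)

/-- The second descent. -/
lemma exists_two_mul_eq {p : ℕ} (hp : p.Prime) (hp2 : p % 2 = 1) (hp5 : p % 5 = 2 ∨ p % 5 = 3)
    {a b r : ℤ} (hb : b ≠ 0) (hab : IsCoprime a b) (H : r ^ 2 = a ^ 4 - 5 * p * b ^ 4) :
    ∃ c : ℚ, (c = 1 ∨ c = 5 ∨ c = 10) ∧ ∃ k : ℚ, 2 * (a ^ 2 + r) = c * k ^ 2 ∨
      2 * (a ^ 2 + r) = 5 * p * (c * k ^ 2) := by
  have hpZ : Prime (p : ℤ) := Nat.prime_iff_prime_int.mp hp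
  have h5Z : Prime (5 : ℤ) := by norm_num
  have hp0 : (0 : ℤ) < p := by exact_mod_cast hp.pos
  have hpQ : (p : ℚ) ≠ 0 := by exact_mod_cast hp.ne_zero
  obtain ⟨A, hA⟩ : ∃ A, A = a ^ 2 + r := ⟨_, rfl⟩
  obtain ⟨B, hB⟩ : ∃ B, B = a ^ 2 - r := ⟨_, rfl⟩
  have hAB : A * B = 5 * p * b ^ 4 := by rw [hA, hB]; linear_combination -H
  have hAB0 : 0 < A * B := by rw [hAB]; positivity
  have hsum : A + B = 2 * a ^ 2 := by rw [hA, hB]; ring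
  have hA0 : 0 < A := by
    by_contra! h
    have : B < 0 := by by_contra!; nlinarith
    nlinarith [sq_nonneg a]
  have hB0 : 0 < B := pos_of_mul_pos_right hAB0 hA0.le
  have hAQ : (2 * (a ^ 2 + r) : ℚ) = 2 * (A : ℚ) := by rw [hA]; push_cast; ring
  rw [hAQ]
  rcases Int.even_or_odd' A with ⟨A', hA' | hA'⟩
  · have hB' : ∃ B', B = 2 * B' := ⟨a ^ 2 - A', by linarith⟩
    obtain ⟨B', rfl⟩ := hB'
    subst hA'
    have hb2 : (2 : ℤ) ∣ b := by
      have h2 : Prime (2 : ℤ) := by norm_num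
      have : (2 : ℤ) ∣ 5 * p * b ^ 4 := ⟨2 * A' * B', by linear_combination -hAB⟩
      rcases h2.dvd_or_dvd this with h | h
      · omega
      · exact h2.dvd_of_dvd_pow h
    obtain ⟨b', rfl⟩ := hb2
    have hAB' : A' * B' = 5 * p * (2 * b' ^ 2) ^ 2 := by linarith
    have hcop : IsCoprime A' B' := by
      refine isCoprime_of_mul_dvd hp hp5 hab (by omega) ⟨4, by linear_combination -hAB⟩
        fun q hq h h' ↦ hq.dvd_of_dvd_pow (n := 2) ?_
      rw [show a ^ 2 = A' + B' by linarith]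
      exact dvd_add h h'
    obtain ⟨k, l, h⟩ := exists_sq_of_mul_eq_prime_mul_prime_mul_sq h5Z (by norm_num) hpZ hp0
      (by omega) (by omega) hcop hAB'
    rcases h with ⟨rfl, -⟩ | ⟨rfl, -⟩ | ⟨rfl, -⟩ | ⟨rfl, -⟩
    · exact ⟨1, by simp, 2 * k, .inl (by push_cast; ring)⟩
    · exact ⟨5, by simp, 2 * k, .inl (by push_cast; ring)⟩
    · exact ⟨5, by simp, 2 * k / 5, .inr (by push_cast; ring)⟩
    · exact ⟨1, by simp, 2 * k, .inr (by push_cast; ring)⟩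
  · have hcop : IsCoprime A B := by
      refine isCoprime_of_mul_dvd hp hp5 hab (by omega) (by rw [hAB]) fun q hq h h' ↦ ?_
      have := dvd_add h h'
      rw [hsum] at this
      rcases hq.dvd_or_dvd this with h2 | h2
      · exact absurd (isUnit_of_dvd_one (by
          have := dvd_sub h (h2.mul_right A')
          rwa [hA', add_sub_cancel_left] at this)) hq.not_isUnit
      · exact hq.dvd_of_dvd_pow h2
    -- Excludes class 2: since 2 is a non-residue modulo 5, a and then b would be divisible by 5.
    -- This keeps the index below 8.
    have h5 {k l : ℤ} (hkl : k ^ 2 * (5 * p * l ^ 2) = 5 * p * (b ^ 2) ^ 2)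
        (h : k ^ 2 + 5 * p * l ^ 2 = 2 * a ^ 2) : False := by
      obtain ⟨h5k, h5a⟩ := five_dvd_of_sq_eq (c := 2) (by norm_num) (a := k) (b := a)
        (d := -p * l ^ 2) (by linear_combination h)
      have : k ^ 2 * l ^ 2 = b ^ 4 :=
        mul_left_cancel₀ (mul_ne_zero h5Z.ne_zero hpZ.ne_zero) (by linear_combination hkl)
      have h5b : (5 : ℤ) ∣ b := h5Z.dvd_of_dvd_pow (n := 4) (by
        rw [← this]; exact (h5k.pow two_ne_zero).mul_right _)
      exact h5Z.not_isUnit (hab.isUnit_of_dvd' h5a h5b)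
    obtain ⟨k, l, h⟩ := exists_sq_of_mul_eq_prime_mul_prime_mul_sq (m := b ^ 2) h5Z (by norm_num)
      hpZ hp0 hA0 hB0 hcop (by rw [hAB]; ring)
    rcases h with ⟨hk, hl⟩ | ⟨hk, hl⟩ | ⟨hk, hl⟩ | ⟨hk, hl⟩
    · exact (h5 (k := k) (l := l) (by rw [← hk, ← hl, hAB]; ring) (by rw [← hk, ← hl, hsum])).elim
    · exact ⟨10, by simp, k, .inl (by rw [hk]; push_cast; ring)⟩
    · exact ⟨10, by simp, k / 5, .inr (by rw [hk]; push_cast; ring)⟩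
    · exact (h5 (k := l) (l := k) (by rw [← hk, ← hl, mul_comm, hAB]; ring)
        (by rw [← hk, ← hl, add_comm, hsum])).elim

/-! ### From integers back to points -/

lemma not_isSquare_five_mul {p : ℕ} (hp5 : p % 5 = 2 ∨ p % 5 = 3) :
    ¬ IsSquare (5 * p : ℚ) := by
  intro h
  have h1 : IsSquare (5 * p : ℕ) := by
    rw [← Rat.isSquare_natCast_iff]
    exact_mod_cast h
  obtain ⟨k, hk⟩ := h1
  have h5 : 5 ∣ k := (Nat.prime_five.dvd_mul.mp ⟨p, hk.symm⟩).elim id id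
  obtain ⟨k, rfl⟩ := h5
  have : p = 5 * (k * k) := by nlinarith
  omega

lemma exists_inClass_of_isSquare {p : ℕ} (hp : p.Prime) (hp2 : p % 2 = 1)
    (hp5 : p % 5 = 2 ∨ p % 5 = 3) {t x y : ℚ} (ht : t ≠ 0) (hx : x = t ^ 2)
    (h : (curveE p).toAffine.Nonsingular x y) :
    ∃ c : ℚ, (c = 1 ∨ c = 5 ∨ c = 10) ∧ InClass p c (.some x y h) := by
  have hE := (curveE_equation_iff p x y).mp h.1
  have hpQ : (p : ℚ) ≠ 0 := by exact_mod_cast hp.ne_zero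
  obtain ⟨s, hs⟩ : ∃ s, s = y / t := ⟨_, rfl⟩
  have hs2 : s ^ 2 = t ^ 4 - 5 * p := by
    rw [hs]
    field_simp
    rw [hE, hx]
    ring
  obtain ⟨a, b, hb, hab, rfl⟩ : ∃ a b : ℤ, b ≠ 0 ∧ IsCoprime a b ∧ t = a / b :=
    ⟨t.num, t.den, by exact_mod_cast t.den_nz, t.isCoprime_num_den, by simp [Rat.num_div_den]⟩
  have hbQ : (b : ℚ) ≠ 0 := by exact_mod_cast hb
  have hr2 : IsSquare (a ^ 4 - 5 * p * b ^ 4) := by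
    rw [← Rat.isSquare_intCast_iff]
    refine ⟨s * b ^ 2, ?_⟩
    push_cast
    field_simp at hs2
    linear_combination -hs2
  obtain ⟨r, hr⟩ := hr2
  obtain ⟨r, hr, hsr⟩ : ∃ r : ℤ, r ^ 2 = a ^ 4 - 5 * p * b ^ 4 ∧ s = r / b ^ 2 := by
    have : (s * b ^ 2) ^ 2 = (r : ℚ) ^ 2 := by
      have : (a ^ 4 - 5 * p * b ^ 4 : ℚ) = r * r := by exact_mod_cast hr
      field_simp at hs2
      linear_combination hs2 + this
    rcases sq_eq_sq_iff_eq_or_eq_neg.mp this with h | h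
    · exact ⟨r, by rw [hr]; ring, by rw [← h]; field_simp⟩
    · exact ⟨-r, by rw [hr]; ring, by push_cast; rw [← h]; field_simp⟩
  obtain ⟨c, hc, k, hk⟩ := exists_two_mul_eq hp hp2 hp5 hb hab hr
  refine ⟨c, hc, ?_⟩
  obtain ⟨d, hd⟩ : ∃ d : ℚ, d = 2 * (x + s) := ⟨_, rfl⟩
  have hd' : d * b ^ 2 = 2 * (a ^ 2 + r) := by
    rw [hd, hx, hsr]
    field_simp
  have hxs : x ^ 2 - 5 * p = s ^ 2 := by rw [hs2, hx]; ring
  have hd0 : d ≠ 0 := by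
    intro h0
    have : (x + s) * (x - s) = 5 * p := by linear_combination hxs
    have hxs0 : x + s = 0 := by linarith
    rw [hxs0, zero_mul] at this
    exact hpQ (by linarith)
  have hxd : x * (4 * d) = d ^ 2 + 20 * p := by
    rw [hd]
    linear_combination 4 * hxs
  rcases hk with hk | hk
  · have hdk : d = c * (k / b) ^ 2 := by
      field_simp
      rw [hd', hk]
    -- Expand x - √(5p) = d(1/2 - √(5p)/d)² with d = c(k/b)². In the other case an extra factor
    -- √(5p) moves inside the square and swaps the roles of u and v.
    refine ⟨a / b, k / b / 2, -(k / b) / d, ht, hx, ?_, ?_⟩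
    · have : c * ((k / b / 2) ^ 2 + 5 * p * (-(k / b) / d) ^ 2) =
        c * (k / b) ^ 2 * (1 / 4 + 5 * p / d ^ 2) := by ring
      rw [this, ← hdk]
      field_simp
      linear_combination hxd
    · have : 2 * c * (k / b / 2) * (-(k / b) / d) = -(c * (k / b) ^ 2) / d := by ring
      rw [this, ← hdk]
      field_simp
  · have hdk : d = 5 * p * (c * (k / b) ^ 2) := by
      field_simp
      linear_combination hd' + hk
    refine ⟨a / b, -5 * p * (k / b) / d, k / b / 2, ht, hx, ?_, ?_⟩
    · have : c * ((-5 * p * (k / b) / d) ^ 2 + 5 * p * (k / b / 2) ^ 2) =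
        5 * p * (c * (k / b) ^ 2) * (1 / 4 + 5 * p / d ^ 2) := by ring
      rw [this, ← hdk]
      field_simp
      linear_combination hxd
    · have : 2 * c * (-5 * p * (k / b) / d) * (k / b / 2) =
        -(5 * p * (c * (k / b) ^ 2)) / d := by ring
      rw [this, ← hdk]
      field_simp

lemma exists_x_eq {p : ℕ} (hp : p.Prime) (hp4 : p % 4 = 3) (hp5 : p % 5 = 2 ∨ p % 5 = 3)
    {x y : ℚ} (h : y ^ 2 = x ^ 3 - 5 * p * x) : ∃ k : ℚ, x = k ^ 2 ∨ x = -5 * p * k ^ 2 := by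
  obtain ⟨m, d, hd, hmd, rfl⟩ : ∃ m d : ℤ, 0 < d ∧ IsCoprime m d ∧ x = m / d :=
    ⟨x.num, x.den, by exact_mod_cast x.den_pos, x.isCoprime_num_den, by simp [Rat.num_div_den]⟩
  have hdQ : (d : ℚ) ≠ 0 := by exact_mod_cast hd.ne'
  have hsq : IsSquare (d * (m * (m ^ 2 - 5 * p * d ^ 2))) := by
    rw [← Rat.isSquare_intCast_iff]
    refine ⟨y * d ^ 2, ?_⟩
    push_cast
    field_simp at h
    linear_combination -d * h
  obtain ⟨N, hN⟩ := hsq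
  -- Coprimality makes the denominator of x a perfect square e².
  have hcop : IsCoprime d (m * (m ^ 2 - 5 * p * d ^ 2)) := by
    refine hmd.symm.mul_right ?_
    have := (hmd.symm.pow_right (n := 2)).add_mul_left_right (-5 * p * d)
    rwa [show m ^ 2 + d * (-5 * p * d) = m ^ 2 - 5 * p * d ^ 2 by ring] at this
  rw [← pow_two] at hN
  obtain ⟨e, he⟩ := Int.sq_of_isCoprime hcop hN
  obtain ⟨M, hM⟩ := Int.sq_of_isCoprime hcop.symm (by rw [mul_comm]; exact hN)
  have he : d = e ^ 2 := he.resolve_right (by nlinarith [sq_nonneg e])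
  have hM : m * (m ^ 2 - 5 * p * d ^ 2) = M ^ 2 := by
    refine hM.elim id fun hM ↦ ?_
    rw [hM] at hN ⊢
    have : M ^ 2 = 0 := by nlinarith [sq_nonneg M, sq_nonneg N]
    rw [this]; rfl
  subst he
  obtain ⟨k, hk⟩ := exists_num_eq hp hp4 hp5 (m := m) (e := e) (N := M)
    (hmd.of_isCoprime_of_dvd_right ⟨e, by ring⟩) (by linear_combination hM)
  refine ⟨k / e, ?_⟩
  rcases hk with rfl | rfl
  · left; push_cast; ring
  · right; push_cast; ring

open WeierstrassCurve in
lemma exists_inClass {p : ℕ} (hp : p.Prime) (hp4 : p % 4 = 3) (hp5 : p % 5 = 2 ∨ p % 5 = 3)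
    (P : (curveE p).toAffine.Point) : ∃ c : ℚ, (c = 1 ∨ c = 5 ∨ c = 10) ∧
      (InClass p c P ∨ InClass p c (P + twoTorsionPoint p hp.ne_zero)) := by
  have hpQ : (p : ℚ) ≠ 0 := by exact_mod_cast hp.ne_zero
  match P with
  | 0 => exact ⟨1, .inl rfl, .inl rfl⟩
  | .some x y h =>
    have hE := (curveE_equation_iff p x y).mp h.1
    by_cases hx : x = 0
    · subst hx
      obtain rfl : y = 0 := by simpa using hE
      refine ⟨1, .inl rfl, .inr ?_⟩
      rw [show Affine.Point.some 0 0 h + twoTorsionPoint p hp.ne_zero = 0 from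
        Affine.Point.add_self_of_Y_eq (by simp [curveE])]
      exact rfl
    · obtain ⟨k, rfl | hk⟩ := exists_x_eq hp hp4 hp5 hE
      · have hk0 : k ≠ 0 := by rintro rfl; simp at hx
        obtain ⟨c, hc, hcP⟩ := exists_inClass_of_isSquare hp (by omega) hp5 hk0 rfl h
        exact ⟨c, hc, .inl hcP⟩
      · have hk0 : k ≠ 0 := by rintro rfl; simp at hk; exact hx hk
        obtain ⟨h₀, hT⟩ : ∃ h₀, twoTorsionPoint p hp.ne_zero = .some 0 0 h₀ := ⟨_, rfl⟩
        rw [hT, Affine.Point.add_of_X_ne hx]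
        have hX : (curveE p).toAffine.addX x 0 ((curveE p).toAffine.slope x 0 y 0) =
            (1 / k) ^ 2 := by
          simp only [Affine.slope_of_X_ne hx, Affine.addX, curveE, sub_zero, zero_mul, add_zero]
          have : (y / x) ^ 2 - x = -5 * p / x := by
            field_simp
            linear_combination hE
          rw [this, hk]
          field_simp
        obtain ⟨c, hc, hcP⟩ := exists_inClass_of_isSquare hp (by omega) hp5 (by positivity) hX
          (Affine.nonsingular_add h h₀ fun h' ↦ hx h'.1)
        exact ⟨c, hc, .inr hcP⟩

/-! ### Counting labels -/

theorem corollary3p1 (p : ℕ) (hp : p.Prime) (hodd : Odd p)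
    (hmod : p ≡ 3 [MOD 40] ∨ p ≡ 27 [MOD 40]) :
    Module.Finite ℤ (curveE p).toAffine.Point ∧
      Module.finrank ℤ (curveE p).toAffine.Point ≤ 1 := by
  have hp4 : p % 4 = 3 := by unfold Nat.ModEq at hmod; omega
  have hp5 : p % 5 = 2 ∨ p % 5 = 3 := by unfold Nat.ModEq at hmod; omega
  have hsq := not_isSquare_five_mul hp5
  set G := (curveE p).toAffine.Point
  set T := twoTorsionPoint p hp.ne_zero
  have hT : T ≠ 0 := WeierstrassCurve.Affine.Point.some_ne_zero _
  have hTT : T + T = 0 :=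
    WeierstrassCurve.Affine.Point.add_self_of_Y_eq (by simp [curveE])
  have hcov (P : G) : ∃ i : Fin 3 × Bool,
      InClass p (![1, 5, 10] i.1) (P + bif i.2 then T else 0) := by
    obtain ⟨c, rfl | rfl | rfl, h | h⟩ := exists_inClass hp hp4 hp5 P
    · exact ⟨(0, false), by simpa using h⟩
    · exact ⟨(0, true), by simpa using h⟩
    · exact ⟨(1, false), by simpa using h⟩
    · exact ⟨(1, true), by simpa using h⟩
    · exact ⟨(2, false), by simpa using h⟩
    · exact ⟨(2, true), by simpa using h⟩
  choose F hF using hcov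
  -- Equal labels use the same translate, and T + T = 0, so P + Q = 2R and -P + Q = 2(R - P).
  have hFG {P Q : G} (h : F P = F Q) : -P + Q ∈ (nsmulAddMonoidHom (α := G) 2).range := by
    have hQ := hF Q
    rw [← h] at hQ
    obtain ⟨R, hR⟩ := ((hF P).add hsq hQ).exists_eq_add_self hsq
    have hε : (bif (F P).2 then T else 0) + (bif (F P).2 then T else 0) = 0 := by
      cases (F P).2 <;> simp [hTT]
    refine ⟨R - P, ?_⟩
    simp only [nsmulAddMonoidHom_apply, two_nsmul]
    have h3 : P + Q = R + R := by rw [← hR, add_add_add_comm, hε, add_zero]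
    rw [show R - P + (R - P) = R + R - P - P by abel, ← h3]
    abel
  have hinj : Function.Injective
      fun q : G ⧸ (nsmulAddMonoidHom (α := G) 2).range ↦ F q.out := by
    intro q q' h
    rw [← q.out_eq', ← q'.out_eq']
    exact QuotientAddGroup.eq.mpr (hFG h)
  have : Finite (G ⧸ (nsmulAddMonoidHom (α := G) 2).range) := Finite.of_injective _ hinj
  have hfi : (nsmulAddMonoidHom (α := G) 2).range.FiniteIndex :=
    AddSubgroup.finiteIndex_of_finite_quotient
  have hcard : (nsmulAddMonoidHom (α := G) 2).range.index ≤ 6 := by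
    have := Nat.card_le_card_of_injective _ hinj
    simpa [AddSubgroup.index] using this
  have hfg : AddGroup.FG G := fg_of_finiteIndex_two p hp.ne_zero hfi
  have hfin : Module.Finite ℤ G := Module.Finite.iff_addGroup_fg.mpr hfg
  exact ⟨hfin, finrank_le_one_of_index_lt hT hTT hfi.index_ne_zero (by omega)⟩
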